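/- Let $k$ be a field and let $h\ge 2$ be an integer. Consider the degree reverse lexicographic monomial order on $k[x_1,x_2,x_3,x_4]$ induced by $x_1>x_2>x_3>x_4$. Let $\mathfrak{Q}_h$ be the defining ideal of the Bresinsky curve, i.e. the kernel of the $k$-algebra homomorphism $\eta\colon k[x_1,x_2,x_3,x_4]\to k[t]$ with $$\eta(x_1)=t^{(2h-1)2h},\quad \eta(x_2)=t^{(2h-1)(2h+1)},\quad \eta(x_3)=t^{2h(2h+1)},\quad \eta(x_4)=t^{2h(2h+1)+2h-1}.$$ Consider the following polynomials: \begin{itemize} \item $p_{1}=x_{2}x_{3}-x_{1}x_{4}$, \item $p_{2}=x_{2}^{2h}-x_{3}^{2h-1}$, \item $p_{(3,j)}=x_{1}^{j+1}x_{3}^{2h-j}-x_{2}^{j}x_{4}^{2h-j}$ for $0\le j\le 2h-1$, \item $p_{(4,i)}=x_{1}^{i+1}x_{2}^{2h-i}-x_{3}^{i-1}x_{4}^{2h-i}$ for $1\le i\le 2h$, \item $p_{5}=x_{3}^{4h}-x_{2}^{2h-1}x_{4}^{2h+1}$, \item $p_{(6,i)}=x_{1}^{2+i}x_{2}^{2h-2-i}x_{4}^{2+i}-x_{3}^{2h+1+i}$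 for $0\le i\le 2h-3$, \item $p_{7}=x_{1}x_{2}^{2h-1}x_{4}-x_{3}^{2h}$, \item $p_{8}=x_{1}^{2h}x_{4}^{2h}-x_{3}^{4h-1}$. \end{itemize} Let $$\mathfrak{G}_h=\{p_1,p_2,p_5,p_7,p_8\}\cup\{p_{(3,j)}\mid 0\le j\le 2h-1\}\cup\{p_{(4,i)}\mid 1\le i\le 2h\}\cup\{p_{(6,i)}\mid 0\le i\le 2h-3\}.$$ Then $\mathfrak{G}_h$ is a Gröbner basis of $\mathfrak{Q}_h$ with respect to the given monomial order, i.e. $\mathfrak{G}_h$ is a finite subset of $\mathfrak{Q}_h$ and the leading terms of its elements generate the ideal generated by the leading terms of all elements of $\mathfrak{Q}_h$. -/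

import Mathlib

/-! ### The degree reverse lexicographic order

As for Mathlib's `MonomialOrder.lex` and `MonomialOrder.degLex`, smaller indices are larger
variables: on `Fin 4` one has `X 0 > X 1 > X 2 > X 3`. -/

/-- Exponent vectors, to be ordered by the degree reverse lexicographic order. -/
def DegRevLex (σ : Type*) : Type _ := σ →₀ ℕ

namespace DegRevLex

variable {σ : Type*}

/-- The identity map onto the type synonym. -/
def of : (σ →₀ ℕ) ≃ DegRevLex σ := Equiv.refl _

/-- The sort key of an exponent vector: first its total degree, then the reverse of the
colexicographic order. -/
noncomputable def key (a : σ →₀ ℕ) : ℕ ×ₗ (Colex (σ →₀ ℕ))ᵒᵈ :=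
  toLex (a.degree, OrderDual.toDual (toColex a))

theorem key_injective : Function.Injective (key (σ := σ)) := fun a b h ↦ by
  simpa [key] using congrArg (fun x ↦ ofColex (OrderDual.ofDual (ofLex x).2)) h

noncomputable instance : AddCommMonoid (DegRevLex σ) := of.symm.addCommMonoid

theorem of_add (a b : σ →₀ ℕ) : of (a + b) = of a + of b := rfl

noncomputable instance [LinearOrder σ] : LinearOrder (DegRevLex σ) :=
  LinearOrder.lift' (fun a ↦ key (of.symm a)) (key_injective.comp of.symm.injective)

variable [LinearOrder σ]

theorem of_le_of {a b : σ →₀ ℕ} :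
    of a ≤ of b ↔ a.degree < b.degree ∨ a.degree = b.degree ∧ toColex b ≤ toColex a := by
  change key a ≤ key b ↔ _
  simp [key, Prod.Lex.toLex_le_toLex]

theorem of_lt_of {a b : σ →₀ ℕ} :
    of a < of b ↔ a.degree < b.degree ∨ a.degree = b.degree ∧ toColex b < toColex a := by
  change key a < key b ↔ _
  simp [key, Prod.Lex.toLex_lt_toLex]

instance : IsOrderedAddMonoid (DegRevLex σ) where
  add_le_add_left a b h c := by
    obtain ⟨a, rfl⟩ := of.surjective a
    obtain ⟨b, rfl⟩ := of.surjective b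
    obtain ⟨c, rfl⟩ := of.surjective c
    rw [of_le_of] at h
    rw [← of_add, ← of_add, of_le_of, map_add, map_add]
    rcases h with h | ⟨h, h'⟩
    · left; omega
    · right; exact ⟨by omega, add_le_add_left h' (toColex c)⟩

theorem of_monotone : Monotone (of (σ := σ)) := fun a b h ↦ by
  obtain ⟨c, rfl⟩ := exists_add_of_le h
  rw [of_le_of, map_add]
  rcases Nat.eq_zero_or_pos c.degree with hc | hc
  · right
    rw [Finsupp.degree_eq_zero_iff] at hc
    simp [hc]
  · left; omega

instance [Finite σ] : WellFoundedLT (DegRevLex σ) := by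
  have : WellQuasiOrderedLE (DegRevLex σ) := ⟨fun f ↦ by
    obtain ⟨i, j, hij, h⟩ :=
      (Finsupp.wellQuasiOrderedLE (α := ℕ) (σ := σ)).wqo (fun n ↦ of.symm (f n))
    exact ⟨i, j, hij, of_monotone h⟩⟩
  infer_instance

end DegRevLex

/-- The degree reverse lexicographic monomial order in finitely many variables. -/
noncomputable def MonomialOrder.degRevLex (σ : Type*) [LinearOrder σ] [Finite σ] :
    MonomialOrder σ where
  syn := DegRevLex σ
  toSyn := { toEquiv := DegRevLex.of, map_add' := DegRevLex.of_add }
  toSyn_monotone := DegRevLex.of_monotone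

open scoped MonomialOrder in
/-- The usual description: `x ^ a < x ^ b` iff the total degree of `a` is smaller, or the total
degrees agree and, at the last index at which `a` and `b` differ, `a` has the larger entry. -/
theorem MonomialOrder.degRevLex_lt_iff {σ : Type*} [LinearOrder σ] [Finite σ] {a b : σ →₀ ℕ} :
    a ≺[MonomialOrder.degRevLex σ] b ↔ a.degree < b.degree ∨
      a.degree = b.degree ∧ ∃ i, (∀ j, i < j → a j = b j) ∧ b i < a i := by
  change DegRevLex.of a < DegRevLex.of b ↔ _
  rw [DegRevLex.of_lt_of, Finsupp.Colex.lt_iff]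
  simp [eq_comm]

/-! ### Gröbner bases -/

/-- `G` is a Gröbner basis of the ideal `I` for the monomial order `m`: a finite subset of `I`
whose leading terms generate the ideal generated by the leading terms of all elements of `I`
(the leading term of `0` is `0`). -/
def IsGroebnerBasis {σ k : Type*} [Field k] (m : MonomialOrder σ)
    (G : Set (MvPolynomial σ k)) (I : Ideal (MvPolynomial σ k)) : Prop :=
  G.Finite ∧ G ⊆ I ∧ Ideal.span (m.leadingTerm '' G) = Ideal.span (m.leadingTerm '' I)

/-! ### Monomial curves and the Bresinsky family -/

/-- The defining ideal of the affine monomial curve with exponents `n`: the kernel of the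
`k`-algebra map `k[x_i] → k[t]`, `x_i ↦ t ^ n_i`. -/
noncomputable def monomialCurveIdeal (k : Type*) [Field k] {σ : Type*} (n : σ → ℕ) :
    Ideal (MvPolynomial σ k) :=
  RingHom.ker (MvPolynomial.aeval (R := k) fun i ↦ (Polynomial.X : Polynomial k) ^ n i)

namespace Bresinsky

open MvPolynomial

/-- The exponents of Bresinsky's curve, for `1 ≤ h`. -/
def exponents (h : ℕ) : Fin 4 → ℕ :=
  ![(2 * h - 1) * (2 * h), (2 * h - 1) * (2 * h + 1), 2 * h * (2 * h + 1),
    2 * h * (2 * h + 1) + (2 * h - 1)]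

variable (k : Type*) [Field k]

/-- The defining ideal of Bresinsky's curve. -/
noncomputable def curveIdeal (h : ℕ) : Ideal (MvPolynomial (Fin 4) k) :=
  monomialCurveIdeal k (exponents h)

/-! The variables `x₁, x₂, x₃, x₄` are `X 0, X 1, X 2, X 3`. The exponents below involve no
truncated subtraction when `2 ≤ h` and the indices lie in the ranges used in `basis`. -/

/-- `x₂ x₃ - x₁ x₄` -/
noncomputable def p₁ : MvPolynomial (Fin 4) k := X 1 * X 2 - X 0 * X 3

/-- `x₂ ^ (2h) - x₃ ^ (2h - 1)` -/
noncomputable def p₂ (h : ℕ) : MvPolynomial (Fin 4) k := X 1 ^ (2 * h) - X 2 ^ (2 * h - 1)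

/-- `x₁ ^ (j + 1) x₃ ^ (2h - j) - x₂ ^ j x₄ ^ (2h - j)` -/
noncomputable def p₃ (h j : ℕ) : MvPolynomial (Fin 4) k :=
  X 0 ^ (j + 1) * X 2 ^ (2 * h - j) - X 1 ^ j * X 3 ^ (2 * h - j)

/-- `x₁ ^ (i + 1) x₂ ^ (2h - i) - x₃ ^ (i - 1) x₄ ^ (2h - i)` -/
noncomputable def p₄ (h i : ℕ) : MvPolynomial (Fin 4) k :=
  X 0 ^ (i + 1) * X 1 ^ (2 * h - i) - X 2 ^ (i - 1) * X 3 ^ (2 * h - i)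

/-- `x₃ ^ (4h) - x₂ ^ (2h - 1) x₄ ^ (2h + 1)` -/
noncomputable def p₅ (h : ℕ) : MvPolynomial (Fin 4) k :=
  X 2 ^ (4 * h) - X 1 ^ (2 * h - 1) * X 3 ^ (2 * h + 1)

/-- `x₁ ^ (2 + i) x₂ ^ (2h - 2 - i) x₄ ^ (2 + i) - x₃ ^ (2h + 1 + i)` -/
noncomputable def p₆ (h i : ℕ) : MvPolynomial (Fin 4) k :=
  X 0 ^ (2 + i) * X 1 ^ (2 * h - 2 - i) * X 3 ^ (2 + i) - X 2 ^ (2 * h + 1 + i)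

/-- `x₁ x₂ ^ (2h - 1) x₄ - x₃ ^ (2h)` -/
noncomputable def p₇ (h : ℕ) : MvPolynomial (Fin 4) k :=
  X 0 * X 1 ^ (2 * h - 1) * X 3 - X 2 ^ (2 * h)

/-- `x₁ ^ (2h) x₄ ^ (2h) - x₃ ^ (4h - 1)` -/
noncomputable def p₈ (h : ℕ) : MvPolynomial (Fin 4) k :=
  X 0 ^ (2 * h) * X 3 ^ (2 * h) - X 2 ^ (4 * h - 1)

/-- The explicit set of binomials. -/
def basis (h : ℕ) : Set (MvPolynomial (Fin 4) k) :=
  {p₁ k, p₂ k h, p₅ k h, p₇ k h, p₈ k h}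
    ∪ {f | ∃ j, 0 ≤ j ∧ j ≤ 2 * h - 1 ∧ f = p₃ k h j}
    ∪ {f | ∃ i, 1 ≤ i ∧ i ≤ 2 * h ∧ f = p₄ k h i}
    ∪ {f | ∃ i, 0 ≤ i ∧ i ≤ 2 * h - 3 ∧ f = p₆ k h i}

end Bresinsky

open MvPolynomial
open scoped MonomialOrder

/-! No S-polynomials are needed. Call a monomial standard if no leading monomial of the basis
divides it. Each binomial has equal weights on both sides, so rewriting turns any monomial into a
standard one of the same weight. If distinct standard monomials have distinct weights, then no
element of the kernel has a standard leading monomial, which is the Gröbner property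
(`isGroebnerBasis_of_weight_injOn`).

For Bresinsky's curve, `standard_of_forall_not_le` turns standardness into a few linear
inequalities. `weight_inj_of_standard` shows that two exponents satisfying them and having equal
weight coincide: congruences modulo `2h` and `2h + 1` parametrise the difference, and the
inequalities leave finitely many cases. -/

/-! ### Binomials in monomial curve ideals -/

/-- The coefficient of `t ^ d` in the image of `f` under `x_i ↦ t ^ n_i` is the sum of the
coefficients of `f` at the exponents of weight `d`. -/
theorem coeff_aeval_X_pow {k σ : Type*} [Field k] (n : σ → ℕ) (f : MvPolynomial σ k) (d : ℕ) :
    (aeval (R := k) (fun i ↦ (Polynomial.X : Polynomial k) ^ n i) f).coeff d =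
      ∑ b ∈ f.support with Finsupp.weight n b = d, f.coeff b := by
  rw [aeval_def, eval₂_eq, Polynomial.finsetSum_coeff, Finset.sum_filter]
  refine Finset.sum_congr rfl fun b _ ↦ ?_
  have : ∏ i ∈ b.support, ((Polynomial.X : Polynomial k) ^ n i) ^ b i =
      Polynomial.X ^ Finsupp.weight n b := by
    simp_rw [← pow_mul, Finset.prod_pow_eq_pow_sum, Finsupp.weight_apply, Finsupp.sum,
      smul_eq_mul, mul_comm]
  rw [this, Polynomial.algebraMap_eq, Polynomial.coeff_C_mul_X_pow]
  simp [eq_comm]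

theorem monomial_sub_monomial_mem_monomialCurveIdeal {k σ : Type*} [Field k] {n : σ → ℕ}
    {a b : σ →₀ ℕ} (h : Finsupp.weight n b = Finsupp.weight n a) :
    monomial a (1 : k) - monomial b 1 ∈ monomialCurveIdeal k n := by
  have key (c : σ →₀ ℕ) : aeval (R := k) (fun i ↦ (Polynomial.X : Polynomial k) ^ n i)
      (monomial c (1 : k)) = Polynomial.X ^ Finsupp.weight n c := by
    simp [aeval_monomial, Finsupp.prod, ← pow_mul, Finset.prod_pow_eq_pow_sum,
      Finsupp.weight_apply, Finsupp.sum, mul_comm]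
  rw [monomialCurveIdeal, RingHom.mem_ker, map_sub, key, key, h, sub_self]

/-- A nonzero element of a monomial curve ideal has an exponent of the same weight as its leading
exponent, and smaller than it. -/
theorem exists_weight_eq_lt_degree {k σ : Type*} [Field k] (m : MonomialOrder σ) {n : σ → ℕ}
    {f : MvPolynomial σ k} (hf : f ∈ monomialCurveIdeal k n) (hf0 : f ≠ 0) :
    ∃ b, Finsupp.weight n b = Finsupp.weight n (m.degree f) ∧ b ≺[m] m.degree f := by
  by_contra! H
  -- Otherwise the leading coefficient alone would be a coefficient of the image of `f`, which is
  -- zero.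
  have hc := coeff_aeval_X_pow n f (Finsupp.weight n (m.degree f))
  rw [monomialCurveIdeal, RingHom.mem_ker] at hf
  rw [hf, Polynomial.coeff_zero,
    Finset.sum_eq_single_of_mem (m.degree f)] at hc
  · exact m.coeff_degree_ne_zero_iff.2 hf0 hc.symm
  · simpa using hf0
  · intro b hb hne
    rw [Finset.mem_filter] at hb
    exact absurd (m.toSyn.injective ((m.le_degree hb.1).antisymm (H b hb.2))) hne

theorem leadingTerm_monomial_sub_monomial {k σ : Type*} [Field k] (m : MonomialOrder σ)
    {a b : σ →₀ ℕ} (h : b ≺[m] a) :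
    m.leadingTerm (monomial a (1 : k) - monomial b 1) = monomial a 1 := by
  classical
  have h' : m.degree (monomial b (1 : k)) ≺[m] m.degree (monomial a (1 : k)) := by
    simpa [m.degree_monomial] using h
  rw [MonomialOrder.leadingTerm, m.degree_sub_of_lt h', m.leadingCoeff_sub_of_lt h']
  simp [m.degree_monomial]

/-- Binomials `x ^ a - x ^ b` in a monomial curve ideal, with leading exponents `a`, form a Gröbner
basis as soon as distinct exponents above none of the `a` have distinct weights. -/
theorem isGroebnerBasis_of_weight_injOn {k σ : Type*} [Field k] (m : MonomialOrder σ) {n : σ → ℕ}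
    {G : Set (MvPolynomial σ k)} (hfin : G.Finite) (B : Set ((σ →₀ ℕ) × (σ →₀ ℕ)))
    (hG : G = (fun p ↦ monomial p.1 1 - monomial p.2 1) '' B)
    (hlt : ∀ p ∈ B, p.2 ≺[m] p.1)
    (hwt : ∀ p ∈ B, Finsupp.weight n p.2 = Finsupp.weight n p.1)
    (hinj : Set.InjOn (Finsupp.weight n) {a | ∀ p ∈ B, ¬ p.1 ≤ a}) :
    IsGroebnerBasis m G (monomialCurveIdeal k n) := by
  have hsub : G ⊆ monomialCurveIdeal k n := by
    rw [hG]
    rintro _ ⟨p, hp, rfl⟩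
    exact monomial_sub_monomial_mem_monomialCurveIdeal (hwt p hp)
  refine ⟨hfin, hsub, (Ideal.span_mono (Set.image_mono hsub)).antisymm ?_⟩
  rw [Ideal.span_le]
  rintro _ ⟨f, hf, rfl⟩
  rcases eq_or_ne f 0 with rfl | hf0
  · simp
  obtain ⟨p, hp, hle⟩ : ∃ p ∈ B, p.1 ≤ m.degree f := by
    by_contra! ha
    obtain ⟨b, hb, hba⟩ := exists_weight_eq_lt_degree m hf hf0
    -- `c` need not occur in `f`. By minimality it is standard: rewriting it by a binomial would
    -- keep the weight and lower the exponent.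
    obtain ⟨c, ⟨hc, hca⟩, hmin⟩ := (InvImage.wf m.toSyn wellFounded_lt).has_min
      {b | Finsupp.weight n b = Finsupp.weight n (m.degree f) ∧ b ≺[m] m.degree f} ⟨b, hb, hba⟩
    have hstd : ∀ p ∈ B, ¬ p.1 ≤ c := by
      intro p hp hpc
      obtain ⟨d, rfl⟩ := exists_add_of_le hpc
      have hlt' : p.2 + d ≺[m] p.1 + d := by simpa using hlt p hp
      refine hmin (p.2 + d) ⟨?_, hlt'.trans hca⟩ hlt'
      rw [← hc, map_add, map_add, hwt p hp]
    exact hca.ne (congrArg _ (hinj hstd ha hc))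
  have : m.leadingTerm f = monomial (m.degree f - p.1) (m.leadingCoeff f) *
      m.leadingTerm (monomial p.1 (1 : k) - monomial p.2 1) := by
    rw [leadingTerm_monomial_sub_monomial m (hlt p hp), monomial_mul, mul_one,
      tsub_add_cancel_of_le hle, MonomialOrder.leadingTerm]
  rw [SetLike.mem_coe, this]
  exact Ideal.mul_mem_left _ _ (Ideal.subset_span ⟨_, hG ▸ ⟨p, hp, rfl⟩, rfl⟩)

/-! ### The arithmetic of the weights -/

/-- The arithmetic core: exponents of the same weight agree if they satisfy the inequalities that hold for
exponents above no leading exponent of Bresinsky's basis. Here `m = 2h`. -/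
theorem weight_inj_of_standard (m a₁ a₂ a₃ a₄ b₁ b₂ b₃ b₄ : ℤ) (hm : 4 ≤ m) (he : Even m)
    (ha1 : 0 ≤ a₁) (ha2 : 0 ≤ a₂) (ha3 : 0 ≤ a₃) (ha4 : 0 ≤ a₄)
    (hb1 : 0 ≤ b₁) (hb2 : 0 ≤ b₂) (hb3 : 0 ≤ b₃) (hb4 : 0 ≤ b₄)
    (a2 : a₂ < m) (a3 : a₃ < 2 * m) (a12 : a₁ + a₂ ≤ m)
    (a13 : a₁ = 0 ∨ a₃ = 0 ∨ a₁ + a₃ ≤ m) (a124 : a₁ + a₂ = m → a₄ < a₁)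
    (b23 : b₂ = 0 ∨ b₃ = 0) (b2 : b₂ < m) (b3 : b₃ < 2 * m) (b12 : b₁ + b₂ ≤ m)
    (b13 : b₁ = 0 ∨ b₃ = 0 ∨ b₁ + b₃ ≤ m) (b124 : b₁ + b₂ = m → b₄ < b₁)
    (hq : b₄ ≤ a₄)
    (hw : a₁ * ((m - 1) * m) + a₂ * ((m - 1) * (m + 1)) + a₃ * (m * (m + 1))
        + a₄ * (m * (m + 1) + (m - 1)) =
      b₁ * ((m - 1) * m) + b₂ * ((m - 1) * (m + 1)) + b₃ * (m * (m + 1))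
        + b₄ * (m * (m + 1) + (m - 1))) :
    a₁ = b₁ ∧ a₂ = b₂ ∧ a₃ = b₃ ∧ a₄ = b₄ := by
  obtain ⟨n, rfl⟩ := he
  -- Modulo `m + 1` the four weights are `2, 0, 0, -2`, and `2` is invertible because `m` is even.
  obtain ⟨s, hs⟩ : n + n + 1 ∣ a₁ - b₁ - (a₄ - b₄) := by
    have h2 : IsCoprime (n + n + 1) 2 := ⟨1, -n, by ring⟩
    refine h2.dvd_of_dvd_mul_right ⟨-((a₁ - b₁) * (n + n - 2) + (a₂ - b₂) * (n + n - 1)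
      + (a₃ - b₃) * (n + n) + (a₄ - b₄) * (n + n + 1)), ?_⟩
    linear_combination hw
  -- Modulo `m` the four weights are `0, -1, 0, -1`.
  obtain ⟨t, ht⟩ : n + n ∣ a₂ - b₂ + (a₄ - b₄) := by
    refine ⟨(a₁ - b₁) * (n + n - 1) + (a₂ - b₂) * (n + n)
      + (a₃ - b₃) * (n + n + 1) + (a₄ - b₄) * (n + n + 2), ?_⟩
    linear_combination -hw
  generalize n + n = m at *
  have hu : a₃ - b₃ + (a₄ - b₄) = -((m - 1) * (s + t)) := by
    have : m * (m + 1) * (a₃ - b₃ + (a₄ - b₄) + (m - 1) * (s + t)) = 0 := by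
      linear_combination hw - (m - 1) * m * hs - (m - 1) * (m + 1) * ht
    have h0 : m * (m + 1) ≠ 0 := by positivity
    have := (mul_eq_zero.1 this).resolve_left h0
    linarith
  have hα : a₁ + a₂ - b₁ - b₂ = (m + 1) * s + m * t := by linarith
  have hβ : a₁ + a₃ - b₁ - b₃ = 2 * s - (m - 1) * t := by linarith
  have hβ1 : a₁ + a₃ - b₁ - b₃ ≤ 2 * m - 1 := by omega
  have hβ2 : -(2 * m - 1) ≤ a₁ + a₃ - b₁ - b₃ := by omega
  have hα1 : a₁ + a₂ - b₁ - b₂ ≤ m := by omega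
  have hα2 : -m ≤ a₁ + a₂ - b₁ - b₂ := by omega
  rw [hβ] at hβ1 hβ2
  rw [hα] at hα1 hα2
  have hD : 0 < m ^ 2 + 2 * m - 1 := by nlinarith only [hm]
  -- Eliminating `s` from the two bounded forms gives `|(m ^ 2 + 2 * m - 1) * t| ≤ 2 * m + (m + 1) *
  -- (2 * m - 1)`, which is less than twice the factor of `t`.
  have ht1 : t < 2 := by
    refine lt_of_mul_lt_mul_left (a := m ^ 2 + 2 * m - 1) ?_ hD.le
    linear_combination 2 * hα1 + mul_le_mul_of_nonneg_left hβ2 (by omega : 0 ≤ m + 1) + hm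
  have ht2 : -2 < t := by
    refine lt_of_mul_lt_mul_left (a := m ^ 2 + 2 * m - 1) ?_ hD.le
    linear_combination 2 * hα2 + mul_le_mul_of_nonneg_left hβ1 (by omega : 0 ≤ m + 1) + hm
  clear hw hβ hβ1 hβ2 hα hD
  have hs1 : s < 2 := by
    refine lt_of_mul_lt_mul_left (a := m + 1) ?_ (by omega)
    linear_combination hα1 + m * (by omega : -1 ≤ t)
  have hs2 : -2 < s := by
    refine lt_of_mul_lt_mul_left (a := m + 1) ?_ (by omega)
    linear_combination hα2 + m * (by omega : t ≤ 1)
  obtain rfl | rfl | rfl : t = -1 ∨ t = 0 ∨ t = 1 := by omega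
  -- With numerals for `s` and `t` everything is linear. For `s = t = 0` the difference is a
  -- multiple of `(1, -1, -1, 1)`, nonnegative by `hq`; a positive one would make `b₂` and `b₃` both
  -- positive, against `b23`.
  all_goals obtain rfl | rfl | rfl : s = -1 ∨ s = 0 ∨ s = 1 := by omega
  all_goals omega

/-! ### Exponents of the Bresinsky binomials -/

namespace Bresinsky

/-- The exponent of the monomial `x₁ ^ a x₂ ^ b x₃ ^ c x₄ ^ d`. -/
noncomputable def expo (a b c d : ℕ) : Fin 4 →₀ ℕ := Finsupp.equivFunOnFinite.symm ![a, b, c, d]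

theorem expo_surjective (e : Fin 4 →₀ ℕ) : ∃ a b c d, e = expo a b c d := by
  refine ⟨e 0, e 1, e 2, e 3, ?_⟩
  ext i
  fin_cases i <;> rfl

theorem expo_le_expo {a b c d a' b' c' d' : ℕ} :
    expo a b c d ≤ expo a' b' c' d' ↔ a ≤ a' ∧ b ≤ b' ∧ c ≤ c' ∧ d ≤ d' := by
  simp [Finsupp.le_def, Fin.forall_fin_succ, expo]

theorem degree_expo (a b c d : ℕ) : (expo a b c d).degree = a + b + c + d := by
  simp [Finsupp.degree_eq_sum, Fin.sum_univ_succ, expo, add_assoc]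

theorem weight_expo (n : Fin 4 → ℕ) (a b c d : ℕ) :
    Finsupp.weight n (expo a b c d) = a * n 0 + b * n 1 + c * n 2 + d * n 3 := by
  simp [Finsupp.weight_apply, Finsupp.sum_fintype, Fin.sum_univ_succ, expo, add_assoc]

theorem monomial_expo {k : Type*} [Field k] (a b c d : ℕ) :
    monomial (expo a b c d) (1 : k) = X 0 ^ a * X 1 ^ b * X 2 ^ c * X 3 ^ d := by
  rw [monomial_eq, map_one, one_mul, Finsupp.prod_fintype _ _ (by simp)]
  simp [Fin.prod_univ_succ, expo, mul_assoc]

theorem expo_lt_of_degree_lt {a b c d a' b' c' d' : ℕ}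
    (h : a + b + c + d < a' + b' + c' + d') :
    expo a b c d ≺[MonomialOrder.degRevLex (Fin 4)] expo a' b' c' d' := by
  rw [MonomialOrder.degRevLex_lt_iff, degree_expo, degree_expo]
  exact Or.inl h

theorem expo_lt_of_last_lt {a b c d a' b' c' d' : ℕ}
    (h : a + b + c + d = a' + b' + c' + d') (hd : d' < d) :
    expo a b c d ≺[MonomialOrder.degRevLex (Fin 4)] expo a' b' c' d' := by
  rw [MonomialOrder.degRevLex_lt_iff, degree_expo, degree_expo]
  exact Or.inr ⟨h, 3, fun j hj ↦ absurd hj (by simpa using Fin.le_last j), hd⟩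

/-- The pairs of exponents of the binomials in `basis`, leading exponents first. -/
def basisExponents (h : ℕ) : Set ((Fin 4 →₀ ℕ) × (Fin 4 →₀ ℕ)) :=
  {(expo 0 1 1 0, expo 1 0 0 1), (expo 0 (2 * h) 0 0, expo 0 0 (2 * h - 1) 0),
    (expo 0 0 (4 * h) 0, expo 0 (2 * h - 1) 0 (2 * h + 1)),
    (expo 1 (2 * h - 1) 0 1, expo 0 0 (2 * h) 0),
    (expo (2 * h) 0 0 (2 * h), expo 0 0 (4 * h - 1) 0)}
    ∪ {p | ∃ j, 0 ≤ j ∧ j ≤ 2 * h - 1 ∧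
      p = (expo (j + 1) 0 (2 * h - j) 0, expo 0 j 0 (2 * h - j))}
    ∪ {p | ∃ i, 1 ≤ i ∧ i ≤ 2 * h ∧
      p = (expo (i + 1) (2 * h - i) 0 0, expo 0 0 (i - 1) (2 * h - i))}
    ∪ {p | ∃ i, 0 ≤ i ∧ i ≤ 2 * h - 3 ∧
      p = (expo (2 + i) (2 * h - 2 - i) 0 (2 + i), expo 0 0 (2 * h + 1 + i) 0)}

theorem basis_eq_image (k : Type*) [Field k] (h : ℕ) :
    basis k h = (fun p ↦ monomial p.1 1 - monomial p.2 1) '' basisExponents h := by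
  have hset (I : ℕ → Prop) (J : ℕ → Prop) (u v : ℕ → Fin 4 →₀ ℕ) :
      (fun p : (Fin 4 →₀ ℕ) × (Fin 4 →₀ ℕ) ↦ monomial p.1 (1 : k) - monomial p.2 1) ''
        {p | ∃ i, I i ∧ J i ∧ p = (u i, v i)} =
      {f | ∃ i, I i ∧ J i ∧ f = monomial (u i) (1 : k) - monomial (v i) 1} := by
    ext f
    constructor
    · rintro ⟨_, ⟨i, hI, hJ, rfl⟩, rfl⟩
      exact ⟨i, hI, hJ, rfl⟩
    · rintro ⟨i, hI, hJ, rfl⟩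
      exact ⟨_, ⟨i, hI, hJ, rfl⟩, rfl⟩
  rw [basisExponents, Set.image_union, Set.image_union, Set.image_union, hset, hset, hset]
  simp only [Set.image_insert_eq, Set.image_singleton, monomial_expo, pow_zero, one_mul, mul_one,
    pow_one]
  rfl

theorem finite_basisExponents (h : ℕ) : (basisExponents h).Finite := by
  have hset (I : ℕ → Prop) (N : ℕ) (u : ℕ → (Fin 4 →₀ ℕ) × (Fin 4 →₀ ℕ)) :
      {p | ∃ i, I i ∧ i ≤ N ∧ p = u i}.Finite :=
    ((Set.finite_Iic N).image u).subset fun p ⟨i, _, hi, hp⟩ ↦ ⟨i, hi, hp.symm⟩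
  exact (((Set.toFinite _).union (hset _ _ _)).union (hset _ _ _)).union (hset _ _ _)

theorem lt_of_mem_basisExponents {h : ℕ} (hh : 2 ≤ h) {p : (Fin 4 →₀ ℕ) × (Fin 4 →₀ ℕ)}
    (hp : p ∈ basisExponents h) : p.2 ≺[MonomialOrder.degRevLex (Fin 4)] p.1 := by
  rcases hp with (((rfl | rfl | rfl | rfl | rfl) | ⟨i, -, hi, rfl⟩) | ⟨i, hi', hi, rfl⟩) |
    ⟨i, -, hi, rfl⟩
  -- Only `p₁` and `p₅` are homogeneous, so there the exponent of `x₄` decides.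
  · exact expo_lt_of_last_lt (by omega) (by omega)
  · exact expo_lt_of_degree_lt (by omega)
  · exact expo_lt_of_last_lt (by omega) (by omega)
  all_goals exact expo_lt_of_degree_lt (by omega)

theorem weight_eq_of_mem_basisExponents {h : ℕ} (hh : 2 ≤ h)
    {p : (Fin 4 →₀ ℕ) × (Fin 4 →₀ ℕ)} (hp : p ∈ basisExponents h) :
    Finsupp.weight (exponents h) p.2 = Finsupp.weight (exponents h) p.1 := by
  rcases hp with (((rfl | rfl | rfl | rfl | rfl) | ⟨i, -, hi, rfl⟩) | ⟨i, hi', hi, rfl⟩) |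
    ⟨i, -, hi, rfl⟩
  all_goals
    simp only [weight_expo, exponents, Matrix.cons_val]
    zify
    repeat rw [Nat.cast_sub (by omega)]
    push_cast
    ring

/-- The exponents above no leading exponent of `basis`. -/
theorem standard_of_forall_not_le {h a b c d : ℕ} (hh : 2 ≤ h)
    (H : ∀ p ∈ basisExponents h, ¬ p.1 ≤ expo a b c d) :
    (b = 0 ∨ c = 0) ∧ b < 2 * h ∧ c < 4 * h ∧ a + b ≤ 2 * h ∧
      (a = 0 ∨ c = 0 ∨ a + c ≤ 2 * h) ∧ (a + b = 2 * h → d < a) := by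
  have h1 := H _ (Or.inl (Or.inl (Or.inl (Or.inl rfl))))
  have h2 := H _ (Or.inl (Or.inl (Or.inl (Or.inr (Or.inl rfl)))))
  have h5 := H _ (Or.inl (Or.inl (Or.inl (Or.inr (Or.inr (Or.inl rfl))))))
  have h7 := H _ (Or.inl (Or.inl (Or.inl (Or.inr (Or.inr (Or.inr (Or.inl rfl)))))))
  have h8 := H _ (Or.inl (Or.inl (Or.inl (Or.inr (Or.inr (Or.inr (Or.inr rfl)))))))
  have h3 (j) (hj : j ≤ 2 * h - 1) := H _ (Or.inl (Or.inl (Or.inr ⟨j, j.zero_le, hj, rfl⟩)))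
  have h4 (i) (hi : 1 ≤ i) (hi' : i ≤ 2 * h) := H _ (Or.inl (Or.inr ⟨i, hi, hi', rfl⟩))
  have h6 (i) (hi : i ≤ 2 * h - 3) := H _ (Or.inr ⟨i, i.zero_le, hi, rfl⟩)
  clear H
  simp only [expo_le_expo] at *
  -- In each family the useful member has the largest power of `x₁` that is at most `x₁ ^ a`, capped
  -- by the index range. For `a = 0` this instance says nothing.
  have h3' := h3 (min a (2 * h) - 1) (by omega)
  have h4' (ha : 2 ≤ a) := h4 (min (a - 1) (2 * h)) (by omega) (by omega)
  have h6' := h6 (a - 2)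
  clear h3 h4 h6
  have hab : a + b ≤ 2 * h := by
    by_cases ha : 2 ≤ a
    · have := h4' ha; omega
    · omega
  refine ⟨by omega, by omega, by omega, hab, by omega, fun hs ↦ ?_⟩
  by_contra hd
  -- The leading monomials of `p₇`, `p₆` and `p₈` form one family `x₁ ^ a x₂ ^ (2h - a) x₄ ^ a`, `1
  -- ≤ a ≤ 2h`, with `p₇` and `p₈` at the two ends.
  rcases (by omega : a = 1 ∨ a = 2 * h ∨ (2 ≤ a ∧ a - 2 ≤ 2 * h - 3)) with ha | ha | ⟨ha, ha'⟩
  · omega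
  · omega
  · have := h6' ha'; omega

theorem weight_injOn {h : ℕ} (hh : 2 ≤ h) :
    Set.InjOn (Finsupp.weight (exponents h)) {a | ∀ p ∈ basisExponents h, ¬ p.1 ≤ a} := by
  intro u hu v hv huv
  obtain ⟨a₁, a₂, a₃, a₄, rfl⟩ := expo_surjective u
  obtain ⟨b₁, b₂, b₃, b₄, rfl⟩ := expo_surjective v
  wlog hq : b₄ ≤ a₄ generalizing a₁ a₂ a₃ a₄ b₁ b₂ b₃ b₄
  · exact (this _ _ _ _ hv _ _ _ _ hu huv.symm (by omega)).symm
  have ha := standard_of_forall_not_le hh hu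
  have hb := standard_of_forall_not_le hh hv
  simp only [weight_expo, exponents, Matrix.cons_val] at huv
  zify at huv
  rw [Nat.cast_sub (by omega)] at huv
  push_cast at huv
  clear hu hv
  obtain ⟨h1, h2, h3, h4⟩ := weight_inj_of_standard (2 * h) a₁ a₂ a₃ a₄ b₁ b₂ b₃ b₄ (by omega)
    (even_two_mul _) (by omega) (by omega) (by omega) (by omega) (by omega) (by omega)
    (by omega) (by omega) (by omega) (by omega) (by omega) (by omega) (by omega) (by omega)
    (by omega) (by omega) (by omega) (by omega) (by omega) (by omega) huv
  norm_cast at h1 h2 h3 h4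
  rw [h1, h2, h3, h4]

end Bresinsky

theorem mainTheorem6 (k : Type*) [Field k] (h : ℕ) (hh : 2 ≤ h) :
    IsGroebnerBasis (MonomialOrder.degRevLex (Fin 4)) (Bresinsky.basis k h)
      (Bresinsky.curveIdeal k h) := by
  refine isGroebnerBasis_of_weight_injOn _ ?_ (Bresinsky.basisExponents h)
    (Bresinsky.basis_eq_image k h) (fun _ ↦ Bresinsky.lt_of_mem_basisExponents hh)
    (fun _ ↦ Bresinsky.weight_eq_of_mem_basisExponents hh) (Bresinsky.weight_injOn hh)
  rw [Bresinsky.basis_eq_image]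
  exact (Bresinsky.finite_basisExponents h).image _
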